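/- **Setting.** Let $G$ be a connected undirected graph on $\{1,\dots,n\}$. A *gossip matrix* on $G$ is a symmetric positive semi-definite matrix $W\in\mathbb R^{n\times n}$ whose kernel is the line of constant vectors and such that $W_{ij}\neq 0$ only if $i=j$ or $\{i,j\}$ is an edge of $G$; its (normalized) *eigengap* $\gamma(W)$ is the ratio of its smallest non-zero eigenvalue to its largest eigenvalue. Functions $f_1,\dots,f_n:\mathbb R^d\to\mathbb R$ satisfy *(A2) with constant $L_\ell$* if each $f_i$ is convex and $L_i$-Lipschitz for the Euclidean norm, with $L_\ell=\sqrt{\frac1n\sum_{i}L_i^2}$; write $\bar f=\frac1n\sum_i f_i$ and $B_2(R)=\{\theta:\|\theta\|_2\le R\}$. Let $\tau>0$ be the communication time. Given subgradient oracles $\nabla f_i$ (that is, $\nabla f_i(\theta)$ is, for each $\theta\in\mathbb R^d$, some subgradient of $f_i$ at $\theta$), a *decentralized black-box procedure* consists of finite memories $\mathcal M_{i,t}\subset\mathbb R^d$ and outputs $\theta_{i,t}\in\mathcal M_{i,t}$, for each node $i$ and each real time $t\ge 0$, with $\mathcal M_{i,0}=\{0\}$ and, for $t>0$, $$\mathcal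 M_{i,t}\subset \mathrm{Span}\big(\{\theta,\nabla f_i(\theta):\theta\in\mathcal M_{i,t-1}\}\big)\ \cup\ \mathrm{Span}\Big(\bigcup_{j=i\text{ or }\{i,j\}\in E(G)}\mathcal M_{j,t-\tau}\Big),$$ where $\mathcal M_{i,s}=\emptyset$ for $s<0$. **Theorem.** There are universal constants $C,c>0$ such that, for all $L_\ell,R>0$ and $\gamma\in(0,1]$, there are an integer $n$, a connected graph $G$ on $\{1,\dots,n\}$ and a gossip matrix $W$ on $G$ with $\gamma(W)=\gamma$ for which the following two statements hold. 1. For all $d\in\mathbb N$, $\tau>0$ and $0\le t<\frac{d-2}{2}\min(\tau/\sqrt\gamma,1)$ there are functions $f_1,\dots,f_n:\mathbb R^d\to\mathbb R$ satisfying (A2) with constant $L_\ell$ such that $\bar f$ has a minimum on $B_2(R)$ and, for all subgradient oracles of the $f_i$, every decentralized black-box procedure satisfies at every node $i\in\{1,\dots,n\}$ $$\bar f(\theta_{i,t})-\min_{\theta\in B_2(R)}\bar f(\theta)\ \ge\ \frac{RL_\ell}{108}\sqrt{\frac{1}{\big(1+\frac{2t\sqrt\gamma}{\tau}\big)^2}+\frac1{1+t}}\,.$$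 2. For all $\tau>0$ and $0<\varepsilon\le c\,RL_\ell$ there is a $D$ such that for every dimension $d\ge D$ there are functions $f_1,\dots,f_n:\mathbb R^d\to\mathbb R$ satisfying (A2) with constant $L_\ell$ such that $\bar f$ has a minimum on $B_2(R)$ and, for all subgradient oracles of the $f_i$, every decentralized black-box procedure, every node $i$ and every time $t\ge0$: if $\bar f(\theta_{i,t})-\min_{\theta\in B_2(R)}\bar f(\theta)\le\varepsilon$, then $$t\ \ge\ C\Big(\frac{RL_\ell}{\varepsilon}\,\frac{\tau}{\sqrt\gamma}+\Big(\frac{RL_\ell}{\varepsilon}\Big)^2\Big).$$ -/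

import Mathlib

noncomputable section

/-- The space `ℝ^d` with its Euclidean norm. -/
abbrev Vec (d : ℕ) : Type := EuclideanSpace ℝ (Fin d)

/-- `W` is a gossip matrix on the network `G`: it is symmetric and positive semi-definite, its
kernel is the line of constant vectors, and it is supported on the diagonal and the edges. -/
structure IsGossipMatrix {n : ℕ} (G : SimpleGraph (Fin n)) (W : Matrix (Fin n) (Fin n) ℝ) :
    Prop where
  symm : W.IsSymm
  posSemidef : W.PosSemidef
  ker_eq : LinearMap.ker (Matrix.toLin' W) = Submodule.span ℝ {fun _ : Fin n => (1 : ℝ)}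
  support : ∀ i j, W i j ≠ 0 → i = j ∨ G.Adj i j

/-- The (finite) set of eigenvalues of a real matrix. -/
def eigenvalueSet {n : ℕ} (W : Matrix (Fin n) (Fin n) ℝ) : Set ℝ :=
  {μ | Module.End.HasEigenvalue (Matrix.toLin' W) μ}

/-- `γ` is the normalized eigengap of `W`: the ratio between its smallest non-zero eigenvalue
and its largest eigenvalue. -/
def HasEigengap {n : ℕ} (W : Matrix (Fin n) (Fin n) ℝ) (γ : ℝ) : Prop :=
  ∃ lmin lmax : ℝ, IsLeast (eigenvalueSet W \ {0}) lmin ∧ IsGreatest (eigenvalueSet W) lmax ∧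
    γ = lmin / lmax

/-- The average `(1/n) ∑ i, f i θ` of the local functions. -/
def avgFun {n d : ℕ} (f : Fin n → Vec d → ℝ) (θ : Vec d) : ℝ :=
  (1 / (n : ℝ)) * ∑ i, f i θ

/-- Local regularity: every local function is convex and `ℓ i`-Lipschitz, where the `ℓ_2`-average
of the local Lipschitz constants `ℓ i` is `L`. -/
def LocalRegularity {n d : ℕ} (f : Fin n → Vec d → ℝ) (L : ℝ) : Prop :=
  ∃ ℓ : Fin n → NNReal,
    (∀ i, ConvexOn ℝ Set.univ (f i) ∧ LipschitzWith (ℓ i) (f i)) ∧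
    L = Real.sqrt ((1 / (n : ℝ)) * ∑ i, (ℓ i : ℝ) ^ 2)

/-- `g` returns, at each point, a subgradient of `f`. -/
def IsSubgradientOracle {d : ℕ} (f : Vec d → ℝ) (g : Vec d → Vec d) : Prop :=
  ∀ x y, f x + inner ℝ (g x) (y - x) ≤ f y

/-- A decentralized black-box optimization procedure on the network `G`, where sending a vector
along an edge takes a time `τ`, a subgradient computation takes one unit of time, and `g i` is the
subgradient oracle of node `i`. Time is continuous.

A node receives combinations of vectors from its neighbors and from itself, so that the weighted
averages `∑ j, W j i • x j` of a gossip matrix on `G` are available as communications. Memories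
are empty before time `0`, so that nothing can be computed before time `1`, or received before
time `τ`, apart from the zero vector. -/
structure BlackBoxProcedure {n d : ℕ} (G : SimpleGraph (Fin n)) (τ : ℝ)
    (g : Fin n → Vec d → Vec d) where
  /-- `mem i t` is the internal memory of node `i` at time `t`. -/
  mem : Fin n → ℝ → Set (Vec d)
  /-- `out i t` is the local output of node `i` at time `t`. -/
  out : Fin n → ℝ → Vec d
  finite_mem : ∀ i t, (mem i t).Finite
  mem_neg : ∀ i t, t < 0 → mem i t = ∅
  mem_zero : ∀ i, mem i 0 = {0}
  /-- Each memory consists of values obtained by local computation or by communication. -/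
  mem_update : ∀ i t, 0 < t →
    mem i t ⊆
      (Submodule.span ℝ (mem i (t - 1) ∪ g i '' mem i (t - 1)) : Set (Vec d)) ∪
      (Submodule.span ℝ (⋃ j ∈ {j | j = i ∨ G.Adj j i}, mem j (t - τ)) : Set (Vec d))
  out_mem : ∀ i t, 0 ≤ t → out i t ∈ mem i t

end

/-! Both terms of the bound come from functions that hide the coordinates of the minimizer: while
the coordinate of index `k` of the output is zero, the value stays far from the minimum over the
ball, and coordinates can only be discovered one after the other. Decreasing offsets of size `η`
make the functions flat, or at least not increasing, when a hidden coordinate moves a little either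
way. Every subgradient then vanishes in that direction, so that no oracle has to be chosen
adversarially.

For computation, all nodes share `L * maxFun η k`: a subgradient reveals at most one new coordinate
per unit of time, and the error stays above `R * L / (2 * √(k + 1))` (`exists_hard_max`). For
communication, the terms of a chain are split by parity between two groups of nodes at distance `Δ`.
Each new coordinate is revealed by one group only, after the previous one has travelled from the
other group, which takes time `Δ * τ`; the error stays above `R * L / (12 * (k + 1))`
(`exists_hard_chain`).

It remains to find a network of eigengap exactly `γ` with `Δ` of order `1 / √γ` and a constant
proportion of the nodes in each group (`exists_network`). The Laplacian of a path on `p` vertices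
has its nonzero eigenvalues in `[1 / p ^ 2, 4]`. Doubling each vertex adds one eigenvalue, carried
by the antisymmetric vectors; chosen as the largest one, it lowers the eigengap to `γ`.

The final rates follow by using the function that matches the larger of the two terms. -/

/-! ### Coordinates and vectors supported on the first ones -/

/-- The `j`-th coordinate of a vector, zero when `j` is out of range. -/
noncomputable def coord {d : ℕ} (j : ℕ) : Vec d →ₗ[ℝ] ℝ :=
  if h : j < d then (EuclideanSpace.proj (𝕜 := ℝ) (⟨j, h⟩ : Fin d)).toLinearMap else 0

theorem coord_of_lt {d j : ℕ} (h : j < d) (x : Vec d) : coord j x = x ⟨j, h⟩ := by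
  simp [coord, h]

theorem coord_of_le {d j : ℕ} (h : d ≤ j) (x : Vec d) : coord j x = 0 := by
  simp [coord, Nat.not_lt.mpr h]

theorem coord_single {d : ℕ} (j : ℕ) (c : Fin d) (s : ℝ) :
    coord j (EuclideanSpace.single c s) = if j = c then s else 0 := by
  by_cases h : j < d
  · simp [coord_of_lt h, Fin.ext_iff]
  · rw [coord_of_le (not_lt.mp h), if_neg]
    have := c.2
    omega

theorem sum_coord_sq_le {d : ℕ} (k : ℕ) (x : Vec d) :
    ∑ j ∈ Finset.range k, coord j x ^ 2 ≤ ‖x‖ ^ 2 := by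
  have h1 : ‖x‖ ^ 2 = ∑ j ∈ Finset.range d, coord j x ^ 2 := by
    rw [EuclideanSpace.real_norm_sq_eq, ← Fin.sum_univ_eq_sum_range (fun j => coord j x ^ 2)]
    exact Finset.sum_congr rfl fun i _ => by rw [coord_of_lt i.2]
  rw [h1]
  have h2 : ∑ j ∈ Finset.range k, coord j x ^ 2 =
      ∑ j ∈ Finset.range k with j < d, coord j x ^ 2 := by
    rw [Finset.sum_filter]
    refine Finset.sum_congr rfl fun j _ => ?_
    split_ifs with h
    · rfl
    · rw [coord_of_le (not_lt.mp h)]; norm_num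
  rw [h2]
  refine Finset.sum_le_sum_of_subset_of_nonneg (fun j hj => ?_) fun _ _ _ => sq_nonneg _
  simp only [Finset.mem_filter, Finset.mem_range] at hj ⊢
  exact hj.2

theorem abs_coord_le {d : ℕ} (j : ℕ) (x : Vec d) : |coord j x| ≤ ‖x‖ := by
  refine abs_le_of_sq_le_sq (le_trans ?_ (sum_coord_sq_le (j + 1) x)) (norm_nonneg x)
  exact Finset.single_le_sum (f := fun j => coord j x ^ 2) (fun _ _ => sq_nonneg _)
    (Finset.self_mem_range_succ j)

theorem sum_abs_coord_le {d : ℕ} (k : ℕ) (x : Vec d) :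
    ∑ j ∈ Finset.range k, |coord j x| ≤ √k * ‖x‖ := by
  refine le_of_sq_le_sq ?_ (by positivity)
  rw [mul_pow, Real.sq_sqrt (Nat.cast_nonneg k)]
  refine le_trans (sq_sum_le_card_mul_sum_sq (s := Finset.range k)) ?_
  simp only [sq_abs, Finset.card_range]
  gcongr
  exact sum_coord_sq_le k x

/-- The vectors whose coordinates vanish from the `m`-th on. -/
def firstCoords (d m : ℕ) : Submodule ℝ (Vec d) where
  carrier := {x | ∀ c : Fin d, m ≤ c → x c = 0}
  add_mem' {x y} hx hy c hc := by simp [hx c hc, hy c hc]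
  zero_mem' c _ := by simp
  smul_mem' a x hx c hc := by simp [hx c hc]

theorem coord_eq_zero_of_mem {d m j : ℕ} {x : Vec d} (hx : x ∈ firstCoords d m) (hj : m ≤ j) :
    coord j x = 0 := by
  by_cases h : j < d
  · rw [coord_of_lt h]; exact hx _ hj
  · exact coord_of_le (not_lt.mp h) x

/-- The vector whose first `k` coordinates are equal to `r`. -/
noncomputable def constVec (d k : ℕ) (r : ℝ) : Vec d :=
  WithLp.toLp 2 fun c : Fin d => if (c : ℕ) < k then r else 0

theorem coord_constVec {d k j : ℕ} (hk : k ≤ d) (hj : j < k) (r : ℝ) :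
    coord j (constVec d k r) = r := by
  rw [coord_of_lt (hj.trans_le hk)]
  simp [constVec, hj]

theorem norm_constVec_le {d k : ℕ} (r : ℝ) : ‖constVec d k r‖ ≤ √k * |r| := by
  refine le_of_sq_le_sq ?_ (by positivity)
  rw [EuclideanSpace.real_norm_sq_eq, mul_pow, Real.sq_sqrt (Nat.cast_nonneg k), sq_abs]
  have h : ∑ i : Fin d, (constVec d k r) i ^ 2 = ∑ j ∈ Finset.range d with j < k, r ^ 2 := by
    rw [Finset.sum_filter, ← Fin.sum_univ_eq_sum_range (fun j => if j < k then r ^ 2 else 0)]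
    refine Finset.sum_congr rfl fun i _ => ?_
    simp only [constVec]
    split_ifs <;> simp
  rw [h, Finset.sum_const, nsmul_eq_mul]
  gcongr
  calc _ ≤ (Finset.range k).card := Finset.card_le_card fun j hj => by simp at hj ⊢; exact hj.2
    _ = k := Finset.card_range k

/-! ### Subgradients, regularity and minima on the ball -/

/-- The subgradient inequality at the two displacements `η` and `-η` bounds the partial slope from
both sides. Since this concerns every subgradient, the lower bounds hold for all oracles. -/
theorem IsSubgradientOracle.apply_eq_zero {d : ℕ} {f : Vec d → ℝ} {g : Vec d → Vec d}
    (hg : IsSubgradientOracle f g) {x : Vec d} {c : Fin d} {η : ℝ} (hη : 0 < η)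
    (h : ∀ s, |s| ≤ η → f (x + EuclideanSpace.single c s) ≤ f x) : g x c = 0 := by
  have key : ∀ s, |s| ≤ η → s * g x c ≤ 0 := by
    intro s hs
    have h1 := hg x (x + EuclideanSpace.single c s)
    have h2 := h s hs
    rw [add_sub_cancel_left, EuclideanSpace.inner_single_right] at h1
    simp at h1
    linarith
  have h1 := key η (abs_of_pos hη).le
  have h2 := key (-η) (by rw [abs_neg]; exact (abs_of_pos hη).le)
  have h3 : η * g x c = 0 := by linarith
  exact (mul_eq_zero.mp h3).resolve_left hη.ne'

/-- Local constants need not be optimal: taking all of them equal to `L` makes their quadratic mean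
exactly `L`. -/
theorem localRegularity_of_forall {n d : ℕ} (hn : 0 < n) {f : Fin n → Vec d → ℝ} {L : ℝ}
    (hL : 0 ≤ L) (hc : ∀ i, ConvexOn ℝ Set.univ (f i))
    (hf : ∀ i x y, |f i x - f i y| ≤ L * ‖x - y‖) : LocalRegularity f L := by
  refine ⟨fun _ => ⟨L, hL⟩, fun i => ⟨hc i, LipschitzWith.of_dist_le_mul fun x y => ?_⟩, ?_⟩
  · rw [Real.dist_eq, dist_eq_norm]; exact hf i x y
  · have : (n : ℝ) ≠ 0 := by positivity
    simp [this]
    exact (Real.sqrt_sq hL).symm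

theorem LocalRegularity.exists_isLeast {n d : ℕ} {f : Fin n → Vec d → ℝ} {L R : ℝ}
    (hf : LocalRegularity f L) (hR : 0 ≤ R) :
    ∃ fmin, IsLeast (avgFun f '' Metric.closedBall 0 R) fmin := by
  obtain ⟨ℓ, h, -⟩ := hf
  have hcont : Continuous (avgFun f) := by
    unfold avgFun
    exact continuous_const.mul (continuous_finsetSum _ fun i _ => (h i).2.continuous)
  obtain ⟨x, hx, hmin⟩ := (isCompact_closedBall (0 : Vec d) R).exists_isMinOn
    ⟨0, by simpa using hR⟩ hcont.continuousOn
  exact ⟨avgFun f x, ⟨x, hx, rfl⟩, by rintro _ ⟨y, hy, rfl⟩; exact hmin hy⟩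

/-! ### Growth of the memories -/

/-- Memories stay in a family of subspaces that is stable under computation and communication. -/
theorem BlackBoxProcedure.mem_subset {n d : ℕ} {G : SimpleGraph (Fin n)} {τ : ℝ}
    {g : Fin n → Vec d → Vec d} (P : BlackBoxProcedure G τ g) (hτ : 0 < τ)
    (K : Fin n → ℝ → Submodule ℝ (Vec d))
    (hself : ∀ i t, 0 ≤ t - 1 → K i (t - 1) ≤ K i t)
    (hgrad : ∀ i t, 0 ≤ t - 1 → ∀ x ∈ K i (t - 1), g i x ∈ K i t)
    (hcomm : ∀ i j t, j = i ∨ G.Adj j i → 0 ≤ t - τ → K j (t - τ) ≤ K i t) (i : Fin n) (t : ℝ) :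
    P.mem i t ⊆ K i t := by
  have hδ : 0 < min 1 τ := lt_min one_pos hτ
  -- Time is continuous, but an update looks back by at least `min 1 τ`; the induction is on the
  -- number of such time slices.
  have key : ∀ N : ℕ, ∀ i t, t < N * min 1 τ → P.mem i t ⊆ K i t := by
    intro N
    induction N with
    | zero => intro i t ht; rw [P.mem_neg i t (by simpa using ht)]; exact Set.empty_subset _
    | succ N ih =>
      intro i t ht
      push_cast at ht
      rcases lt_trichotomy t 0 with h0 | h0 | h0
      · rw [P.mem_neg i t h0]; exact Set.empty_subset _
      · rw [h0, P.mem_zero]; simp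
      refine (P.mem_update i t h0).trans (Set.union_subset ?_ ?_)
      · refine SetLike.coe_subset_coe.mpr (Submodule.span_le.mpr ?_)
        rcases lt_or_ge (t - 1) 0 with h1 | h1
        · rw [P.mem_neg i _ h1]; simp
        have hi := ih i (t - 1) (by linarith [min_le_left 1 τ])
        refine Set.union_subset (fun x hx => hself i t h1 (hi hx)) ?_
        rintro _ ⟨x, hx, rfl⟩
        exact hgrad i t h1 x (hi hx)
      · refine SetLike.coe_subset_coe.mpr (Submodule.span_le.mpr (Set.iUnion₂_subset fun j hj => ?_))
        rcases lt_or_ge (t - τ) 0 with h1 | h1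
        · rw [P.mem_neg j _ h1]; simp
        exact fun x hx => hcomm i j t hj h1 (ih j (t - τ) (by linarith [min_le_right 1 τ]) hx)
  obtain ⟨N, hN⟩ := exists_nat_gt (t / min 1 τ)
  exact key N i t ((div_lt_iff₀ hδ).mp hN)

/-- If a subgradient reveals at most one new coordinate, at most `m` are known before `m + 1`. -/
theorem BlackBoxProcedure.mem_firstCoords_of_compute {n d : ℕ} {G : SimpleGraph (Fin n)} {τ : ℝ}
    {g : Fin n → Vec d → Vec d} (P : BlackBoxProcedure G τ g) (hτ : 0 < τ)
    (hg : ∀ i m, ∀ x ∈ firstCoords d m, g i x ∈ firstCoords d (m + 1))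
    {i : Fin n} {t : ℝ} {m : ℕ} (ht : t < m + 1) {x : Vec d} (hx : x ∈ P.mem i t) :
    x ∈ firstCoords d m := by
  let K : Fin n → ℝ → Submodule ℝ (Vec d) := fun _ t =>
    ⨅ m : ℕ, ⨅ _ : t < m + 1, firstCoords d m
  have hK : ∀ i t x, x ∈ K i t ↔ ∀ m : ℕ, t < m + 1 → x ∈ firstCoords d m := by
    intro i t x; simp [K]
  refine (hK i t x).mp (P.mem_subset hτ K ?_ ?_ ?_ i t hx) m ht
  · intro i t _ x hx
    exact (hK i _ _).mpr fun m hm => (hK i _ _).mp hx m (by linarith)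
  · intro i t h0 x hx
    refine (hK i _ _).mpr fun m hm => ?_
    obtain - | m := m
    · norm_num at hm; linarith
    · exact hg i m x ((hK i _ _).mp hx m (by push_cast at hm; linarith))
  · intro i j t _ _ x hx
    exact (hK i _ _).mpr fun m hm => (hK j _ _).mp hx m (by linarith)

/-- If even (resp. odd) coordinates are only revealed at the nodes of height `0` (resp. `Δ`), then
each new coordinate costs `Δ` communications. -/
theorem BlackBoxProcedure.mem_firstCoords_of_comm {n d : ℕ} {G : SimpleGraph (Fin n)} {τ : ℝ}
    {g : Fin n → Vec d → Vec d} (P : BlackBoxProcedure G τ g) (hτ : 0 < τ)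
    {h : Fin n → ℕ} {Δ : ℕ} (hle : ∀ i, h i ≤ Δ) (hadj : ∀ i j, G.Adj i j → h i ≤ h j + 1)
    (hg : ∀ i m, ∀ x ∈ firstCoords d m, g i x ∈ firstCoords d (m + 1))
    (heven : ∀ i m, h i ≠ 0 → m % 2 = 0 → ∀ x ∈ firstCoords d m, g i x ∈ firstCoords d m)
    (hodd : ∀ i m, h i ≠ Δ → m % 2 = 1 → ∀ x ∈ firstCoords d m, g i x ∈ firstCoords d m)
    {i : Fin n} {t : ℝ} {m : ℕ} (ht : t < m * Δ * τ) {x : Vec d} (hx : x ∈ P.mem i t) :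
    x ∈ firstCoords d m := by
  -- `H m i` bounds from below the distance from `i` to the group that can reveal the coordinate
  -- `m`. This coordinate takes `m * Δ` communications to appear in that group, and at least `H m i`
  -- more to reach `i`.
  let H : ℕ → Fin n → ℕ := fun m i => if m % 2 = 0 then h i else Δ - h i
  have hH : ∀ m i j, j = i ∨ G.Adj j i → H m i ≤ H m j + 1 := by
    intro m i j hij
    rcases hij with rfl | hij
    · omega
    · have h1 := hadj _ _ hij
      have h2 := hadj _ _ hij.symm
      simp only [H]; split_ifs <;> omega
  let K : Fin n → ℝ → Submodule ℝ (Vec d) := fun i t =>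
    ⨅ m : ℕ, ⨅ _ : t < ((m * Δ + H m i : ℕ) : ℝ) * τ, firstCoords d m
  have hK : ∀ i t x, x ∈ K i t ↔
      ∀ m : ℕ, t < ((m * Δ + H m i : ℕ) : ℝ) * τ → x ∈ firstCoords d m := by
    intro i t x; simp only [K, Submodule.mem_iInf]
  refine (hK i t x).mp (P.mem_subset hτ K ?_ ?_ ?_ i t hx) m (ht.trans_le ?_)
  · intro i t _ x hx
    exact (hK i _ _).mpr fun m hm => (hK i _ _).mp hx m (by linarith)
  · intro i t h0 x hx
    refine (hK _ _ _).mpr fun m hm => ?_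
    by_cases hz : H m i = 0
    · obtain - | m := m
      · rw [hz] at hm; norm_num at hm; linarith
      -- A node that can reveal the coordinate `m + 1` is at height distance `Δ` from the group of
      -- the coordinate `m`, so that the two deadlines coincide.
      · have e : (m + 1) * Δ + H (m + 1) i = m * Δ + H m i := by
          have := hle i
          rw [hz, add_mul]
          simp only [H] at hz ⊢
          rcases Nat.mod_two_eq_zero_or_one m with h2 | h2
          · rw [if_neg (by omega)] at hz
            rw [if_pos h2]; omega
          · rw [if_pos (by omega)] at hz
            rw [if_neg (by omega)]; omega
        rw [e] at hm
        exact hg i m x ((hK _ _ _).mp hx m (by linarith))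
    · have hx' := (hK _ _ _).mp hx m (by linarith)
      simp only [H] at hz
      rcases Nat.mod_two_eq_zero_or_one m with h2 | h2
      · rw [if_pos h2] at hz
        exact heven i m hz h2 x hx'
      · rw [if_neg (by omega)] at hz
        exact hodd i m (by omega) h2 x hx'
  · intro i j t hij _ x hx
    refine (hK _ _ _).mpr fun m hm => (hK _ _ _).mp hx m ?_
    have h1 : ((m * Δ + H m i : ℕ) : ℝ) ≤ ((m * Δ + H m j : ℕ) : ℝ) + 1 := by
      exact_mod_cast (by have := hH m i j hij; omega : m * Δ + H m i ≤ m * Δ + H m j + 1)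
    nlinarith
  · push_cast
    have : (0 : ℝ) ≤ (H m i : ℝ) := Nat.cast_nonneg _
    nlinarith

/-! ### The chain and the communication bound -/

/-- The functions `-θ 0` and `max (θ (j - 1) - θ j - η) 0`, whose sum has to be minimized
coordinate after coordinate. -/
noncomputable def chainTerm {d : ℕ} (η : ℝ) : ℕ → Vec d → ℝ
  | 0, x => -coord 0 x
  | j + 1, x => max (coord j x - coord (j + 1) x - η) 0

theorem convexOn_chainTerm {d : ℕ} (η : ℝ) (j : ℕ) :
    ConvexOn ℝ Set.univ (chainTerm (d := d) η j) := by
  cases j with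
  | zero => exact (-coord (d := d) 0).convexOn convex_univ
  | succ j =>
    exact (((coord (d := d) j - coord (j + 1)).convexOn convex_univ).sub
      (concaveOn_const η convex_univ)).sup (convexOn_const 0 convex_univ)

theorem abs_max_sub_max_zero_le (a b : ℝ) : |max a 0 - max b 0| ≤ |a - b| := by
  have := abs_max_sub_max_le_max a 0 b 0
  simpa using this

/-- Each coordinate enters at most two terms, hence a bound by twice the `ℓ_1` norm. With absolute
values inside the sum, it applies to both parity classes. -/
theorem sum_abs_chainTerm_sub_le {d : ℕ} (η : ℝ) (k : ℕ) (x y : Vec d) :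
    ∑ j ∈ Finset.range k, |chainTerm η j x - chainTerm η j y| ≤ 2 * (√k * ‖x - y‖) := by
  have h : ∀ k, ∑ j ∈ Finset.range (k + 1), |chainTerm η j x - chainTerm η j y| ≤
      ∑ j ∈ Finset.range (k + 1), |coord j (x - y)| + ∑ j ∈ Finset.range k, |coord j (x - y)| := by
    intro k
    induction k with
    | zero =>
      simp only [zero_add, Finset.range_one, Finset.sum_singleton, chainTerm, Finset.range_zero,
        Finset.sum_empty, map_sub]
      rw [add_zero, ← abs_neg]
      exact le_of_eq (by congr 1; ring)
    | succ k ih =>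
      rw [Finset.sum_range_succ, Finset.sum_range_succ (fun j => |coord j (x - y)|) (k + 1),
        Finset.sum_range_succ (fun j => |coord j (x - y)|) k]
      rw [Finset.sum_range_succ (fun j => |coord j (x - y)|) k] at ih
      have h1 : |chainTerm η (k + 1) x - chainTerm η (k + 1) y| ≤
          |coord k (x - y)| + |coord (k + 1) (x - y)| := by
        refine (abs_max_sub_max_zero_le _ _).trans (le_trans (le_of_eq ?_) (abs_sub _ _))
        simp only [map_sub]
        congr 1; ring
      linarith
  cases k with
  | zero => simp
  | succ k =>
    refine (h k).trans ?_
    have h1 := sum_abs_coord_le (k + 1) (x - y)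
    have h2 : ∑ j ∈ Finset.range k, |coord j (x - y)| ≤
        ∑ j ∈ Finset.range (k + 1), |coord j (x - y)| := by
      rw [Finset.sum_range_succ]
      linarith [abs_nonneg (coord k (x - y))]
    linarith

/-- The term `m` is the only one that sees the coordinates from the `m`-th on. -/
theorem chainTerm_add_single {d m j : ℕ} {η s : ℝ} {x : Vec d} (hx : x ∈ firstCoords d m)
    {c : Fin d} (hc : m ≤ c) (hj : (c : ℕ) = m → j ≠ m) (hs : |s| ≤ η) :
    chainTerm η j (x + EuclideanSpace.single c s) = chainTerm η j x := by
  obtain ⟨hs1, hs2⟩ := abs_le.mp hs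
  cases j with
  | zero =>
    simp only [chainTerm, map_add, coord_single]
    rw [if_neg (by omega), add_zero]
  | succ j =>
    simp only [chainTerm, map_add, coord_single]
    -- When `c` enters the term, both of its coordinates vanish at `x`: the offset `η` absorbs `s`
    -- and the maximum stays `0`.
    by_cases h1 : j = c
    · have e1 := coord_eq_zero_of_mem hx (j := j) (by omega)
      have e2 := coord_eq_zero_of_mem hx (j := j + 1) (by omega)
      rw [if_pos h1, if_neg (by omega), e1, e2, max_eq_right (by linarith),
        max_eq_right (by linarith)]
    by_cases h2 : j + 1 = c
    · have e1 := coord_eq_zero_of_mem hx (j := j) (by omega)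
      have e2 := coord_eq_zero_of_mem hx (j := j + 1) (by omega)
      rw [if_neg h1, if_pos h2, e1, e2, max_eq_right (by linarith), max_eq_right (by linarith)]
    · rw [if_neg h1, if_neg h2, add_zero, add_zero]

/-- The sum telescopes once each maximum is bounded below by its first argument. -/
theorem neg_coord_sub_le_sum_chainTerm {d : ℕ} (η : ℝ) (k : ℕ) (x : Vec d) :
    -coord k x - k * η ≤ ∑ j ∈ Finset.range (k + 1), chainTerm η j x := by
  induction k with
  | zero => simp [chainTerm]
  | succ k ih =>
    rw [Finset.sum_range_succ]
    have := le_max_left (coord k x - coord (k + 1) x - η) 0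
    push_cast
    change _ ≤ _ + max (coord k x - coord (k + 1) x - η) 0
    linarith

theorem sum_chainTerm_constVec {d k : ℕ} (hk : k + 1 ≤ d) {η : ℝ} (hη : 0 ≤ η) (r : ℝ) :
    ∑ j ∈ Finset.range (k + 1), chainTerm η j (constVec d (k + 1) r) = -r := by
  rw [Finset.sum_range_succ', Finset.sum_eq_zero]
  · simp [chainTerm, coord_constVec hk]
  · intro j hj
    have hj' := Finset.mem_range.mp hj
    simp only [chainTerm]
    rw [coord_constVec hk (by omega), coord_constVec hk (by omega)]
    simp [hη]

/-- The sum of the terms of the chain of length `k` whose index has parity `b`. -/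
noncomputable def chainFun {d : ℕ} (η : ℝ) (k b : ℕ) (x : Vec d) : ℝ :=
  ∑ j ∈ Finset.range k with j % 2 = b, chainTerm η j x

theorem convexOn_chainFun {d : ℕ} (η : ℝ) (k b : ℕ) :
    ConvexOn ℝ Set.univ (chainFun (d := d) η k b) := by
  have : chainFun (d := d) η k b = ∑ j ∈ Finset.range k with j % 2 = b, chainTerm η j := by
    ext x; simp [chainFun]
  rw [this]
  exact Finset.sum_induction _ (ConvexOn ℝ Set.univ) (fun _ _ h₁ h₂ => h₁.add h₂)
    (convexOn_const 0 convex_univ) fun j _ => convexOn_chainTerm η j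

theorem abs_chainFun_sub_le {d : ℕ} (η : ℝ) (k b : ℕ) (x y : Vec d) :
    |chainFun η k b x - chainFun η k b y| ≤ 2 * (√k * ‖x - y‖) := by
  unfold chainFun
  rw [← Finset.sum_sub_distrib]
  refine (Finset.abs_sum_le_sum_abs _ _).trans (le_trans ?_ (sum_abs_chainTerm_sub_le η k x y))
  exact Finset.sum_le_sum_of_subset_of_nonneg (Finset.filter_subset _ _) fun _ _ _ => abs_nonneg _

theorem chainFun_add_single {d m : ℕ} {η s : ℝ} (k b : ℕ) {x : Vec d} (hx : x ∈ firstCoords d m)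
    {c : Fin d} (hc : m ≤ c) (hb : (c : ℕ) = m → m % 2 ≠ b) (hs : |s| ≤ η) :
    chainFun η k b (x + EuclideanSpace.single c s) = chainFun η k b x := by
  refine Finset.sum_congr rfl fun j hj => chainTerm_add_single hx hc (fun h1 h2 => ?_) hs
  simp only [Finset.mem_filter] at hj
  exact hb h1 (h2 ▸ hj.2)

theorem chainFun_zero_add_chainFun_one {d : ℕ} (η : ℝ) (k : ℕ) (x : Vec d) :
    chainFun η k 0 x + chainFun η k 1 x = ∑ j ∈ Finset.range k, chainTerm η j x := by
  unfold chainFun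
  rw [← Finset.sum_filter_add_sum_filter_not (Finset.range k) (fun j => j % 2 = 0)]
  congr 1
  refine Finset.sum_congr (Finset.filter_congr fun j _ => by omega) fun _ _ => rfl

/-- As the groups have the same size, the two halves of the chain recombine with equal weights. -/
theorem avgFun_eq_of_two_values {n d : ℕ} (h : Fin n → ℕ) {Δ s : ℕ} (hΔ : 0 < Δ)
    (h0 : (Finset.univ.filter fun i => h i = 0).card = s)
    (h1 : (Finset.univ.filter fun i => h i = Δ).card = s) (u v : Vec d → ℝ) (x : Vec d) :
    avgFun (fun i x => if h i = 0 then u x else if h i = Δ then v x else 0) x =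
      s / n * (u x + v x) := by
  have : ∑ i, (if h i = 0 then u x else if h i = Δ then v x else 0) =
      ∑ i, ((if h i = 0 then u x else 0) + if h i = Δ then v x else 0) := by
    refine Finset.sum_congr rfl fun i _ => ?_
    split_ifs <;> first | omega | simp
  rw [avgFun, this, Finset.sum_add_distrib, ← Finset.sum_filter, ← Finset.sum_filter,
    Finset.sum_const, Finset.sum_const, h0, h1, nsmul_eq_mul, nsmul_eq_mul]
  ring

/-- The lower bound for the communication. -/
theorem exists_hard_chain {n d k : ℕ} {G : SimpleGraph (Fin n)} {h : Fin n → ℕ} {Δ s : ℕ}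
    (hΔ : 0 < Δ) (hle : ∀ i, h i ≤ Δ) (hadj : ∀ i j, G.Adj i j → h i ≤ h j + 1)
    (h0 : (Finset.univ.filter fun i => h i = 0).card = s)
    (h1 : (Finset.univ.filter fun i => h i = Δ).card = s) (hn : 0 < n) (hs : n ≤ 3 * s)
    {L R : ℝ} (hL : 0 < L) (hR : 0 < R) (hk : k + 1 ≤ d) :
    ∃ f : Fin n → Vec d → ℝ, LocalRegularity f L ∧
      ∃ fmin : ℝ, IsLeast (avgFun f '' Metric.closedBall 0 R) fmin ∧
        ∀ g : Fin n → Vec d → Vec d, (∀ i, IsSubgradientOracle (f i) (g i)) →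
          ∀ τ : ℝ, 0 < τ → ∀ P : BlackBoxProcedure G τ g, ∀ (i : Fin n) (t : ℝ), 0 ≤ t →
            t < k * Δ * τ ∨ t < k + 1 →
              R * L / (12 * (k + 1)) ≤ avgFun f (P.out i t) - fmin := by
  set r : ℝ := √((k + 1 : ℕ) : ℝ) with hr
  have hr2 : r ^ 2 = k + 1 := by rw [hr, Real.sq_sqrt (Nat.cast_nonneg _)]; push_cast; rfl
  have hr0 : 0 < r := Real.sqrt_pos.mpr (by positivity)
  -- As `k ≤ r ^ 2`, the offsets cost at most `k * η ≤ R / (2 * r)`, half of the decrease `R / r`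
  -- reached by a constant vector of norm `R`. The factor `a` below compensates the Lipschitz
  -- constant `2 * r` of the chain.
  set η : ℝ := R / (2 * r ^ 3) with hηdef
  have hη : 0 < η := by positivity
  set a : ℝ := L / (2 * r) with hadef
  have ha : 0 < a := by positivity
  let u : Vec d → ℝ := fun x => a * chainFun η (k + 1) 0 x
  let v : Vec d → ℝ := fun x => a * chainFun η (k + 1) 1 x
  let f : Fin n → Vec d → ℝ := fun i x => if h i = 0 then u x else if h i = Δ then v x else 0
  have hf : ∀ i, (h i = 0 ∧ f i = u) ∨ (h i = Δ ∧ f i = v) ∨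
      (h i ≠ 0 ∧ h i ≠ Δ ∧ f i = fun _ => 0) := by
    intro i
    by_cases c0 : h i = 0
    · exact Or.inl ⟨c0, by ext x; simp [f, c0]⟩
    by_cases c1 : h i = Δ
    · refine Or.inr (Or.inl ⟨c1, ?_⟩)
      ext x; simp only [f]; rw [if_neg c0, if_pos c1]
    · exact Or.inr (Or.inr ⟨c0, c1, by ext x; simp [f, c0, c1]⟩)
  have hlip : ∀ b (x y : Vec d), |a * chainFun η (k + 1) b x - a * chainFun η (k + 1) b y| ≤
      L * ‖x - y‖ := by
    intro b x y
    rw [← mul_sub, abs_mul, abs_of_pos ha]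
    refine (mul_le_mul_of_nonneg_left (abs_chainFun_sub_le η (k + 1) b x y) ha.le).trans ?_
    rw [← hr, hadef]
    apply le_of_eq
    field_simp
  have hreg : LocalRegularity f L := by
    refine localRegularity_of_forall hn hL.le (fun i => ?_) fun i x y => ?_
    · rcases hf i with ⟨-, e⟩ | ⟨-, e⟩ | ⟨-, -, e⟩ <;> rw [e]
      · exact (convexOn_chainFun η (k + 1) 0).smul ha.le
      · exact (convexOn_chainFun η (k + 1) 1).smul ha.le
      · exact convexOn_const 0 convex_univ
    · rcases hf i with ⟨-, e⟩ | ⟨-, e⟩ | ⟨-, -, e⟩ <;> rw [e]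
      · exact hlip 0 x y
      · exact hlip 1 x y
      · simp; positivity
  obtain ⟨fmin, hmin⟩ := hreg.exists_isLeast hR.le
  refine ⟨f, hreg, fmin, hmin, ?_⟩
  intro g hg τ hτ P i t ht htk
  have hzero : ∀ i m (x : Vec d), x ∈ firstCoords d m → ∀ c : Fin d, m ≤ c →
      ((c : ℕ) = m → (h i = 0 → m % 2 ≠ 0) ∧ (h i = Δ → m % 2 ≠ 1)) → g i x c = 0 := by
    intro i m x hx c hc hb
    refine (hg i).apply_eq_zero hη fun σ hσ => le_of_eq ?_
    rcases hf i with ⟨hi, e⟩ | ⟨hi, e⟩ | ⟨-, -, e⟩ <;> rw [e]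
    · exact congrArg (a * ·) (chainFun_add_single _ _ hx hc (fun hcm => (hb hcm).1 hi) hσ)
    · exact congrArg (a * ·) (chainFun_add_single _ _ hx hc (fun hcm => (hb hcm).2 hi) hσ)
  have hcomp : ∀ i m, ∀ x ∈ firstCoords d m, g i x ∈ firstCoords d (m + 1) :=
    fun i m x hx c hc => hzero i m x hx c (by omega) fun hcm => by omega
  have hout : P.out i t ∈ firstCoords d k := by
    rcases htk with htk | htk
    · refine P.mem_firstCoords_of_comm hτ hle hadj hcomp ?_ ?_ htk (P.out_mem i t ht)
      · exact fun i m hi hm x hx c hc => hzero i m x hx c hc fun _ =>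
          ⟨fun h => absurd h hi, fun _ => by omega⟩
      · exact fun i m hi hm x hx c hc => hzero i m x hx c hc fun _ =>
          ⟨fun _ => by omega, fun h => absurd h hi⟩
    · exact P.mem_firstCoords_of_compute hτ hcomp htk (P.out_mem i t ht)
  have havg : ∀ x, avgFun f x =
      s / n * (a * ∑ j ∈ Finset.range (k + 1), chainTerm η j x) := by
    intro x
    rw [avgFun_eq_of_two_values h hΔ h0 h1 u v x, ← chainFun_zero_add_chainFun_one, ← mul_add]
  have hfmin : fmin ≤ s / n * (a * -(R / r)) := by
    rw [← sum_chainTerm_constVec hk hη.le (R / r), ← havg]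
    refine hmin.2 ⟨_, ?_, rfl⟩
    rw [mem_closedBall_zero_iff]
    refine (norm_constVec_le _).trans (le_of_eq ?_)
    rw [← hr, abs_of_pos (by positivity)]
    field_simp
  have hlow := neg_coord_sub_le_sum_chainTerm η k (P.out i t)
  rw [coord_eq_zero_of_mem hout le_rfl] at hlow
  have hkη : k * η ≤ R / (2 * r) := by
    have : (k : ℝ) ≤ r ^ 2 := by rw [hr2]; linarith
    calc k * η ≤ r ^ 2 * η := by gcongr
      _ = R / (2 * r) := by rw [hηdef]; field_simp
  have hn' : (0 : ℝ) < n := by exact_mod_cast hn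
  have hsn : (1 : ℝ) / 3 ≤ s / n := by
    rw [div_le_div_iff₀ (by norm_num) hn']
    have : (n : ℝ) ≤ 3 * s := by exact_mod_cast hs
    linarith
  calc R * L / (12 * (k + 1)) = 1 / 3 * (a * (R / (2 * r))) := by
        rw [← hr2, hadef]; field_simp; norm_num
    _ ≤ s / n * (a * (R / (2 * r))) := by gcongr
    _ ≤ s / n * (a * (∑ j ∈ Finset.range (k + 1), chainTerm η j (P.out i t) + R / r)) := by
        gcongr
        have : R / r = R / (2 * r) + R / (2 * r) := by field_simp; norm_num
        linarith
    _ ≤ _ := by rw [havg]; linarith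

/-! ### The maximum and the computation bound -/

/-- The maximum of the first `k + 1` coordinates, with decreasing offsets. -/
noncomputable def maxFun {d : ℕ} (η : ℝ) (k : ℕ) (x : Vec d) : ℝ :=
  (Finset.range (k + 1)).sup' Finset.nonempty_range_add_one fun j => coord j x - j * η

theorem convexOn_maxFun {d : ℕ} (η : ℝ) (k : ℕ) : ConvexOn ℝ Set.univ (maxFun (d := d) η k) := by
  have : maxFun (d := d) η k = (Finset.range (k + 1)).sup' Finset.nonempty_range_add_one
      fun j x => coord j x - j * η := by
    ext x; simp [maxFun, Finset.sup'_apply]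
  rw [this]
  refine Finset.sup'_induction (p := ConvexOn ℝ Set.univ) _ _ (fun _ h₁ _ h₂ => h₁.sup h₂) ?_
  exact fun j _ => ((coord (d := d) j).convexOn convex_univ).sub (concaveOn_const _ convex_univ)

theorem maxFun_sub_le {d : ℕ} (η : ℝ) (k : ℕ) (x y : Vec d) :
    maxFun η k x - maxFun η k y ≤ ‖x - y‖ := by
  rw [sub_le_iff_le_add]
  refine Finset.sup'_le _ _ fun j hj => ?_
  have h1 := Finset.le_sup' (fun j => coord j y - j * η) hj
  have h2 := (le_abs_self _).trans (abs_coord_le j (x - y))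
  rw [map_sub] at h2
  simp only [maxFun]
  linarith

theorem abs_maxFun_sub_le {d : ℕ} (η : ℝ) (k : ℕ) (x y : Vec d) :
    |maxFun η k x - maxFun η k y| ≤ ‖x - y‖ := by
  refine abs_le.mpr ⟨?_, maxFun_sub_le η k x y⟩
  have := maxFun_sub_le η k y x
  rw [norm_sub_rev] at this
  linarith

/-- At `x` the entry `m` equals `-m * η` and exceeds the later ones by at least `η`, so that raising
one of these by at most `η` cannot change which value dominates. A subgradient thus reveals no
coordinate beyond `m`. -/
theorem maxFun_add_single_le {d m k : ℕ} {η s : ℝ} {x : Vec d} (hx : x ∈ firstCoords d m)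
    {c : Fin d} (hc : m < c) (hs : |s| ≤ η) :
    maxFun η k (x + EuclideanSpace.single c s) ≤ maxFun η k x := by
  refine Finset.sup'_le _ _ fun j hj => ?_
  rw [map_add, coord_single]
  split_ifs with h
  · have hm : m ∈ Finset.range (k + 1) := by simp at hj ⊢; omega
    refine le_trans ?_ (Finset.le_sup' (fun j => coord j x - j * η) hm)
    rw [coord_eq_zero_of_mem hx (by omega), coord_eq_zero_of_mem hx le_rfl]
    have h1 : (m : ℝ) + 1 ≤ j := by exact_mod_cast (by omega : m + 1 ≤ j)
    have h2 := (abs_le.mp hs).2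
    have h3 : 0 ≤ η := (abs_nonneg s).trans hs
    nlinarith
  · rw [add_zero]
    exact Finset.le_sup' (fun j => coord j x - j * η) hj

/-- The lower bound for the computation. -/
theorem exists_hard_max {n d k : ℕ} {G : SimpleGraph (Fin n)} (hn : 0 < n)
    {L R : ℝ} (hL : 0 < L) (hR : 0 < R) (hk : k + 1 ≤ d) :
    ∃ f : Fin n → Vec d → ℝ, LocalRegularity f L ∧
      ∃ fmin : ℝ, IsLeast (avgFun f '' Metric.closedBall 0 R) fmin ∧
        ∀ g : Fin n → Vec d → Vec d, (∀ i, IsSubgradientOracle (f i) (g i)) →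
          ∀ τ : ℝ, 0 < τ → ∀ P : BlackBoxProcedure G τ g, ∀ (i : Fin n) (t : ℝ), 0 ≤ t →
            t < k + 1 → R * L / (2 * √(k + 1)) ≤ avgFun f (P.out i t) - fmin := by
  set r : ℝ := √(k + 1) with hr
  have hr2 : r ^ 2 = k + 1 := by rw [hr, Real.sq_sqrt (by positivity)]
  have hr0 : 0 < r := Real.sqrt_pos.mpr (by positivity)
  set η : ℝ := R / (2 * r ^ 3) with hηdef
  have hη : 0 < η := by positivity
  let f : Fin n → Vec d → ℝ := fun _ x => L * maxFun η k x
  have hreg : LocalRegularity f L := by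
    refine localRegularity_of_forall hn hL.le
      (fun i => (convexOn_maxFun η k).smul hL.le) fun i x y => ?_
    rw [← mul_sub, abs_mul, abs_of_pos hL]
    gcongr
    exact abs_maxFun_sub_le η k x y
  obtain ⟨fmin, hmin⟩ := hreg.exists_isLeast hR.le
  refine ⟨f, hreg, fmin, hmin, ?_⟩
  intro g hg τ hτ P i t ht htk
  have hcomp : ∀ i m, ∀ x ∈ firstCoords d m, g i x ∈ firstCoords d (m + 1) := by
    intro i m x hx c hc
    refine (hg i).apply_eq_zero hη fun σ hσ => ?_
    exact mul_le_mul_of_nonneg_left (maxFun_add_single_le hx (by omega) hσ) hL.le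
  have hout := P.mem_firstCoords_of_compute hτ hcomp htk (P.out_mem i t ht)
  have havg : ∀ x, avgFun f x = L * maxFun η k x := by
    intro x
    have : (n : ℝ) ≠ 0 := by positivity
    simp [avgFun, f, this]
  have hfmin : fmin ≤ L * -(R / r) := by
    refine le_trans (hmin.2 ⟨constVec d (k + 1) (-(R / r)), ?_, rfl⟩) ?_
    · rw [mem_closedBall_zero_iff]
      refine (norm_constVec_le _).trans (le_of_eq ?_)
      rw [abs_neg, abs_of_pos (by positivity), Nat.cast_add, Nat.cast_one, ← hr]
      field_simp
    · rw [havg]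
      gcongr
      refine Finset.sup'_le _ _ fun j hj => ?_
      rw [coord_constVec hk (by simpa using hj)]
      have : 0 ≤ j * η := by positivity
      linarith
  have hlow : -(k * η) ≤ maxFun η k (P.out i t) := by
    refine le_trans (le_of_eq ?_)
      (Finset.le_sup' (fun j => coord j (P.out i t) - j * η) (Finset.self_mem_range_succ k))
    simp [coord_eq_zero_of_mem hout le_rfl]
  have hkη : k * η ≤ R / (2 * r) := by
    have : (k : ℝ) ≤ r ^ 2 := by rw [hr2]; linarith
    calc k * η ≤ r ^ 2 * η := by gcongr
      _ = R / (2 * r) := by rw [hηdef]; field_simp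
  calc R * L / (2 * r) = L * (R / r - R / (2 * r)) := by field_simp; norm_num
    _ ≤ L * (R / r - k * η) := by gcongr
    _ ≤ L * (maxFun η k (P.out i t) + R / r) := by gcongr; linarith
    _ ≤ _ := by rw [havg]; linarith

/-! ### Spectrum of the Laplacian of a path -/

open Matrix in
theorem hasEigenvalue_toLin'_iff {n : ℕ} {W : Matrix (Fin n) (Fin n) ℝ} {μ : ℝ} :
    Module.End.HasEigenvalue (Matrix.toLin' W) μ ↔ ∃ v ≠ 0, W *ᵥ v = μ • v := by
  constructor
  · intro h
    obtain ⟨v, hv⟩ := h.exists_hasEigenvector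
    exact ⟨v, hv.2, by simpa using hv.apply_eq_smul⟩
  · rintro ⟨v, hv, h⟩
    exact Module.End.hasEigenvalue_of_hasEigenvector
      (x := v) ⟨Module.End.mem_eigenspace_iff.mpr (by simpa using h), hv⟩

theorem lapMatrix_mulVec_eq_sum {p : ℕ} (G : SimpleGraph (Fin p)) [DecidableRel G.Adj]
    (u : Fin p → ℝ) (i : Fin p) :
    (G.lapMatrix ℝ).mulVec u i = ∑ j, if G.Adj i j then u i - u j else 0 := by
  rw [SimpleGraph.lapMatrix_mulVec_apply, ← Finset.sum_filter, Finset.sum_sub_distrib,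
    Finset.sum_const, nsmul_eq_mul, ← SimpleGraph.neighborFinset_eq_filter,
    SimpleGraph.card_neighborFinset_eq_degree]

noncomputable instance pathGraph.decidableRelAdj (p : ℕ) :
    DecidableRel (SimpleGraph.pathGraph p).Adj := Classical.decRel _

/-- The Laplacian of the path on `p` vertices, in terms of a function on `ℕ`. -/
theorem lapMatrix_pathGraph_mulVec {p : ℕ} (U : ℕ → ℝ) (i : Fin p) :
    (((SimpleGraph.pathGraph p).lapMatrix ℝ).mulVec fun j => U j) i =
      (if (i : ℕ) + 1 < p then U i - U (i + 1) else 0) + if 0 < (i : ℕ) then U i - U (i - 1) else 0 := by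
  rw [lapMatrix_mulVec_eq_sum]
  have h1 : ∀ j : Fin p, (if (SimpleGraph.pathGraph p).Adj i j then U i - U j else 0) =
      (if (i : ℕ) + 1 = j then U i - U (i + 1) else 0) +
        if 0 < (i : ℕ) then (if (i : ℕ) - 1 = j then U i - U (i - 1) else 0) else 0 := by
    intro j
    simp only [SimpleGraph.pathGraph_adj]
    by_cases h2 : (i : ℕ) + 1 = j
    · rw [if_pos (Or.inl h2), if_pos h2, if_neg (c := (i : ℕ) - 1 = j) (by omega), ite_self, h2,
        add_zero]
    · rw [if_neg h2, zero_add]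
      by_cases h3 : (j : ℕ) + 1 = i
      · rw [if_pos (Or.inr h3), if_pos (by omega), if_pos (by omega)]
        congr 2; omega
      · rw [if_neg (by tauto)]
        split_ifs <;> first | rfl | omega
  simp_rw [h1]
  rw [Finset.sum_add_distrib]
  congr 1
  · rw [Fin.sum_univ_eq_sum_range (fun j => if (i : ℕ) + 1 = j then U i - U (i + 1) else 0),
      Finset.sum_ite_eq]
    simp
  · split_ifs with h
    · rw [Fin.sum_univ_eq_sum_range (fun j => if (i : ℕ) - 1 = j then U i - U (i - 1) else 0),
        Finset.sum_ite_eq, if_pos]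
      simp; omega
    · simp

theorem eigenvalueSet_nonneg {p : ℕ} {P : Matrix (Fin p) (Fin p) ℝ} (hP : P.PosSemidef) {μ : ℝ}
    (hμ : μ ∈ eigenvalueSet P) : 0 ≤ μ := by
  obtain ⟨v, hv, h⟩ := hasEigenvalue_toLin'_iff.mp hμ
  have h1 := hP.dotProduct_mulVec_nonneg v
  rw [h, dotProduct_smul, smul_eq_mul] at h1
  have h2 : 0 < star v ⬝ᵥ v := Matrix.dotProduct_star_self_pos_iff.mpr hv
  exact nonneg_of_mul_nonneg_left h1 h2

/-- A function on the path which satisfies the eigenvalue equation of the Laplacian. -/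
theorem exists_path_eigenvector {p : ℕ} {μ : ℝ}
    (hμ : μ ∈ eigenvalueSet ((SimpleGraph.pathGraph p).lapMatrix ℝ)) :
    ∃ U : ℕ → ℝ, (∃ i < p, U i ≠ 0) ∧ ∀ i < p, (if i + 1 < p then U i - U (i + 1) else 0) +
      (if 0 < i then U i - U (i - 1) else 0) = μ * U i := by
  obtain ⟨v, hv, h⟩ := hasEigenvalue_toLin'_iff.mp hμ
  let U : ℕ → ℝ := fun i => if hi : i < p then v ⟨i, hi⟩ else 0
  have hU : v = fun j : Fin p => U j := by ext j; simp [U]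
  refine ⟨U, ?_, fun i hi => ?_⟩
  · obtain ⟨j, hj⟩ := Function.ne_iff.mp hv
    exact ⟨j, j.2, by rw [hU] at hj; exact hj⟩
  · have h1 := lapMatrix_pathGraph_mulVec U (⟨i, hi⟩ : Fin p)
    rw [← hU, h] at h1
    rw [← h1, hU]
    simp

theorem exists_max_abs {p : ℕ} (U : ℕ → ℝ) (h : ∃ i < p, U i ≠ 0) :
    ∃ m < p, 0 < |U m| ∧ ∀ i < p, |U i| ≤ |U m| := by
  obtain ⟨i, hi, h0⟩ := h
  obtain ⟨m, hm, hmax⟩ := (Finset.range p).exists_max_image (fun i => |U i|)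
    ⟨i, Finset.mem_range.mpr hi⟩
  exact ⟨m, by simpa using hm, (abs_pos.mpr h0).trans_le (hmax i (by simpa using hi)),
    fun j hj => hmax j (by simpa using hj)⟩

/-- At an entry of largest modulus, there are at most two neighbors and each difference is at most
twice this modulus. -/
theorem path_eigenvalue_le {p : ℕ} {μ : ℝ}
    (hμ : μ ∈ eigenvalueSet ((SimpleGraph.pathGraph p).lapMatrix ℝ)) : μ ≤ 4 := by
  obtain ⟨U, h0, hU⟩ := exists_path_eigenvector hμ
  obtain ⟨m, hm, hpos, hmax⟩ := exists_max_abs U h0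
  have h1 : ∀ (c : Prop) [Decidable c] (j : ℕ), (c → j < p) →
      |if c then U m - U j else 0| ≤ 2 * |U m| := by
    intro c _ j hj
    split_ifs with hc
    · have := abs_sub (U m) (U j)
      linarith [hmax j (hj hc)]
    · simp
  have h2 := h1 (m + 1 < p) (m + 1) id
  have h3 := h1 (0 < m) (m - 1) fun _ => by omega
  have h4 : μ * |U m| ≤ 4 * |U m| := by
    calc μ * |U m| ≤ |μ| * |U m| := by gcongr; exact le_abs_self μ
      _ = |μ * U m| := (abs_mul _ _).symm
      _ ≤ _ := by
        rw [← hU m hm]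
        refine (abs_add_le _ _).trans ?_
        linarith
  exact le_of_mul_le_mul_right h4 hpos

/-- Summing the eigenvalue equation from one end writes each increment as `μ` times a partial sum,
hence at most `μ * p * |U m|`, where `|U m|` is maximal. The total sum is zero, so some entry does
not have the strict sign of `U m`; going from `m` to it takes at most `p` increments, which add up
to at least `|U m|`. -/
theorem le_path_eigenvalue {p : ℕ} {μ : ℝ}
    (hμ : μ ∈ eigenvalueSet ((SimpleGraph.pathGraph p).lapMatrix ℝ)) (hμ0 : μ ≠ 0) :
    1 / (p : ℝ) ^ 2 ≤ μ := by
  have hnn := eigenvalueSet_nonneg (SimpleGraph.posSemidef_lapMatrix ℝ _) hμ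
  obtain ⟨U, h0, hU⟩ := exists_path_eigenvector hμ
  obtain ⟨m, hm, hpos, hmax⟩ := exists_max_abs U h0
  have hflux : ∀ i, i + 1 < p → U i - U (i + 1) = μ * ∑ k ∈ Finset.range (i + 1), U k := by
    intro i
    induction i with
    | zero => intro hi; simpa [hi] using hU 0 (by omega)
    | succ i ih =>
      intro hi
      have h1 := ih (by omega)
      have h2 := hU (i + 1) (by omega)
      rw [if_pos hi, if_pos (by omega), Nat.add_sub_cancel] at h2
      rw [Finset.sum_range_succ, mul_add, ← h1, ← h2]
      ring
  have hsum : ∑ k ∈ Finset.range p, U k = 0 := by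
    obtain ⟨q, rfl⟩ : ∃ q, p = q + 1 := ⟨p - 1, by omega⟩
    have h2 := hU q (by omega)
    rw [if_neg (by omega)] at h2
    refine (mul_eq_zero.mp (?_ : μ * _ = 0)).resolve_left hμ0
    rw [Finset.sum_range_succ, mul_add, ← h2]
    rcases Nat.eq_zero_or_pos q with rfl | hq
    · simp
    · obtain ⟨r, rfl⟩ : ∃ r, q = r + 1 := ⟨q - 1, by omega⟩
      rw [← hflux r (by omega)]
      simp
  have hstep : ∀ i, i + 1 < p → |U i - U (i + 1)| ≤ μ * (p * |U m|) := by
    intro i hi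
    rw [hflux i hi, abs_mul, abs_of_nonneg hnn]
    gcongr
    refine (Finset.abs_sum_le_sum_abs _ _).trans ?_
    refine (Finset.sum_le_card_nsmul _ _ |U m| fun k hk => hmax k ?_).trans ?_
    · simp at hk; omega
    · rw [Finset.card_range, nsmul_eq_mul]
      gcongr
  have hdist : ∀ a b, a ≤ b → b < p → |U a - U b| ≤ p * (μ * (p * |U m|)) := by
    intro a b hab hb
    have h1 := dist_le_Ico_sum_of_dist_le (f := U) hab (d := fun _ => μ * (p * |U m|))
      fun {k} _ hk => by rw [Real.dist_eq]; exact hstep k (by omega)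
    rw [Real.dist_eq, Finset.sum_const, Nat.card_Ico, nsmul_eq_mul] at h1
    refine h1.trans ?_
    gcongr
    omega
  obtain ⟨j, hj, hneg⟩ : ∃ j < p, U m * U j ≤ 0 := by
    by_contra! hcon
    have : 0 < ∑ k ∈ Finset.range p, U m * U k :=
      Finset.sum_pos (fun k hk => hcon k (by simpa using hk)) ⟨m, by simpa using hm⟩
    rw [← Finset.mul_sum, hsum, mul_zero] at this
    exact this.false
  have hle : |U m| ≤ |U m - U j| := by
    refine sq_le_sq.mp ?_
    nlinarith [sq_nonneg (U j)]
  have hfin : |U m| ≤ p * (μ * (p * |U m|)) := by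
    rcases le_total m j with h | h
    · exact hle.trans (hdist m j h hj)
    · rw [abs_sub_comm] at hle
      exact hle.trans (hdist j m h hm)
  have hp : (0 : ℝ) < p := by exact_mod_cast (by omega : 0 < p)
  rw [div_le_iff₀ (by positivity)]
  refine le_of_mul_le_mul_right ?_ hpos
  linarith

theorem path_two_eigenvalue {μ : ℝ}
    (hμ : μ ∈ eigenvalueSet ((SimpleGraph.pathGraph 2).lapMatrix ℝ)) (hμ0 : μ ≠ 0) : μ = 2 := by
  obtain ⟨U, ⟨i, hi, h0⟩, hU⟩ := exists_path_eigenvector hμ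
  have h1 := hU 0 (by omega)
  have h2 := hU 1 (by omega)
  norm_num at h1 h2
  have h3 : U 0 + U 1 = 0 := by
    refine (mul_eq_zero.mp (?_ : μ * _ = 0)).resolve_left hμ0
    linarith
  have h4 : U 1 = - U 0 := by linarith
  have h5 : U 0 ≠ 0 := by
    intro h6
    interval_cases i <;> simp_all
  refine mul_right_cancel₀ h5 ?_
  rw [← h1, h4]; ring

theorem exists_isLeast_path_eigenvalue {p : ℕ} (hp : 2 ≤ p) :
    ∃ lmin, IsLeast (eigenvalueSet ((SimpleGraph.pathGraph p).lapMatrix ℝ) \ {0}) lmin := by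
  set P := (SimpleGraph.pathGraph p).lapMatrix ℝ with hPdef
  have hP : P.IsHermitian := SimpleGraph.isHermitian_lapMatrix ℝ _
  have hne : P ≠ 0 := by
    intro h
    have h1 := lapMatrix_pathGraph_mulVec (fun i => (i : ℝ)) (⟨0, by omega⟩ : Fin p)
    rw [← hPdef, h] at h1
    simp [show 1 < p by omega] at h1
  obtain ⟨i, hi⟩ := Function.ne_iff.mp (mt hP.eigenvalues_eq_zero_iff.mp hne)
  have hmem : hP.eigenvalues i ∈ eigenvalueSet P \ {0} := by
    refine ⟨hasEigenvalue_toLin'_iff.mpr ⟨_, ?_, hP.mulVec_eigenvectorBasis i⟩, hi⟩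
    intro h
    apply hP.eigenvectorBasis.orthonormal.ne_zero i
    ext j; exact congrFun h j
  have hfin : (eigenvalueSet P \ {0}).Finite := (Module.End.finite_hasEigenvalue _).sdiff
  obtain ⟨l, hl, hmin⟩ := Set.exists_min_image _ id hfin ⟨_, hmem⟩
  exact ⟨l, hl, fun μ hμ => hmin μ hμ⟩

/-! ### Doubling the vertices to adjust the eigengap -/

open Matrix in
/-- The blow-up of a matrix: each index `a` is replaced by `2 * a` and `2 * a + 1`. The symmetric
vectors are acted on by `P`, and the antisymmetric ones by `x`. -/
noncomputable def blowUp {p : ℕ} (P : Matrix (Fin p) (Fin p) ℝ) (x : ℝ) :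
    Matrix (Fin (p * 2)) (Fin (p * 2)) ℝ :=
  fun i j => P i.divNat j.divNat / 2 +
    x * ((if i = j then 1 else 0) - if i.divNat = j.divNat then 1 / 2 else 0)

theorem divNat_finProdFinEquiv {p : ℕ} (a : Fin p) (b : Fin 2) :
    (finProdFinEquiv (a, b)).divNat = a :=
  congrArg Prod.fst (finProdFinEquiv.symm_apply_apply (a, b))

theorem sum_fin_mul_two {p : ℕ} (F : Fin (p * 2) → ℝ) :
    ∑ j, F j = ∑ a, (F (finProdFinEquiv (a, 0)) + F (finProdFinEquiv (a, 1))) := by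
  rw [← finProdFinEquiv.sum_comp, Fintype.sum_prod_type]
  simp only [Fin.sum_univ_two]

/-- The sum of the two copies of each coordinate. -/
def foldVec {p : ℕ} (v : Fin (p * 2) → ℝ) (a : Fin p) : ℝ :=
  v (finProdFinEquiv (a, 0)) + v (finProdFinEquiv (a, 1))

open Matrix in
theorem blowUp_mulVec {p : ℕ} (P : Matrix (Fin p) (Fin p) ℝ) (x : ℝ) (v : Fin (p * 2) → ℝ)
    (i : Fin (p * 2)) :
    (blowUp P x *ᵥ v) i =
      (P *ᵥ foldVec v) i.divNat / 2 + x * (v i - foldVec v i.divNat / 2) := by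
  have h1 : (P *ᵥ foldVec v) i.divNat / 2 = ∑ j, P i.divNat j.divNat / 2 * v j := by
    rw [sum_fin_mul_two]
    simp only [divNat_finProdFinEquiv, mulVec, dotProduct, foldVec, Finset.sum_div]
    exact Finset.sum_congr rfl fun a _ => by ring
  have h2 : foldVec v i.divNat / 2 = ∑ j, (if i.divNat = j.divNat then 1 / 2 else 0) * v j := by
    rw [sum_fin_mul_two]
    simp only [divNat_finProdFinEquiv, ← mul_add, foldVec]
    simp
    ring
  have h3 : v i = ∑ j, (if i = j then 1 else 0) * v j := by simp
  have h4 : x * (v i - foldVec v i.divNat / 2) = x * (∑ j, (if i = j then 1 else 0) * v j -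
      ∑ j, (if i.divNat = j.divNat then 1 / 2 else 0) * v j) := by rw [← h2, ← h3]
  rw [h1, h4]
  rw [← Finset.sum_sub_distrib, Finset.mul_sum, ← Finset.sum_add_distrib]
  rw [mulVec, dotProduct]
  exact Finset.sum_congr rfl fun j _ => by simp only [blowUp]; ring

open Matrix in
theorem foldVec_blowUp_mulVec {p : ℕ} (P : Matrix (Fin p) (Fin p) ℝ) (x : ℝ)
    (v : Fin (p * 2) → ℝ) : foldVec (blowUp P x *ᵥ v) = P *ᵥ foldVec v := by
  ext a
  rw [foldVec, blowUp_mulVec, blowUp_mulVec, divNat_finProdFinEquiv, divNat_finProdFinEquiv]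
  rw [foldVec]
  ring

open Matrix in
theorem isSymm_blowUp {p : ℕ} {P : Matrix (Fin p) (Fin p) ℝ} (hP : P.IsSymm) (x : ℝ) :
    (blowUp P x).IsSymm := by
  ext i j
  simp only [transpose_apply, blowUp, hP.apply, eq_comm]

open Matrix in
theorem posSemidef_blowUp {p : ℕ} {P : Matrix (Fin p) (Fin p) ℝ} (hP : P.PosSemidef)
    (hs : P.IsSymm) {x : ℝ} (hx : 0 ≤ x) : (blowUp P x).PosSemidef := by
  refine .of_dotProduct_mulVec_nonneg ?_ fun v => ?_
  · rw [IsHermitian, conjTranspose_eq_transpose_of_trivial]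
    exact isSymm_blowUp hs x
  · have h1 := hP.dotProduct_mulVec_nonneg (foldVec v)
    rw [star_trivial] at h1 ⊢
    -- The quadratic form splits along symmetric and antisymmetric parts.
    have h2 : v ⬝ᵥ blowUp P x *ᵥ v = foldVec v ⬝ᵥ P *ᵥ foldVec v / 2 +
        ∑ a, x / 2 * (v (finProdFinEquiv (a, 0)) - v (finProdFinEquiv (a, 1))) ^ 2 := by
      rw [dotProduct, sum_fin_mul_two, dotProduct, Finset.sum_div, ← Finset.sum_add_distrib]
      refine Finset.sum_congr rfl fun a _ => ?_
      rw [blowUp_mulVec, blowUp_mulVec, divNat_finProdFinEquiv, divNat_finProdFinEquiv]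
      generalize (P *ᵥ foldVec v) a = y
      rw [foldVec]
      ring
    rw [h2]
    have : 0 ≤ ∑ a, x / 2 * (v (finProdFinEquiv (a, 0)) - v (finProdFinEquiv (a, 1))) ^ 2 :=
      Finset.sum_nonneg fun _ _ => by positivity
    linarith

open Matrix in
theorem ker_blowUp {p : ℕ} {P : Matrix (Fin p) (Fin p) ℝ}
    (hP : ∀ u, P *ᵥ u = 0 ↔ ∃ c : ℝ, u = fun _ => c) {x : ℝ} (hx : x ≠ 0) :
    LinearMap.ker (toLin' (blowUp P x)) = Submodule.span ℝ {fun _ => (1 : ℝ)} := by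
  ext v
  rw [LinearMap.mem_ker, toLin'_apply, Submodule.mem_span_singleton]
  constructor
  · intro h
    have h1 : P *ᵥ foldVec v = 0 := by
      rw [← foldVec_blowUp_mulVec P x, h]
      ext a; simp [foldVec]
    obtain ⟨c, hc⟩ := (hP _).mp h1
    refine ⟨c / 2, ?_⟩
    ext i
    have h2 := congrFun h i
    rw [blowUp_mulVec, h1, hc] at h2
    have h3 := (mul_eq_zero.mp (by simpa using h2 : x * (v i - c / 2) = 0)).resolve_left hx
    simp; linarith
  · rintro ⟨c, rfl⟩
    have h1 : foldVec (p := p) (c • fun _ => (1 : ℝ)) = fun _ => c + c := by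
      ext a; simp [foldVec]
    ext i
    rw [blowUp_mulVec, h1, (hP _).mpr ⟨_, rfl⟩]
    simp

-- Folding intertwines the blow-up with `P`: the fold of an eigenvector is either an eigenvector of
-- `P` or zero, and in the latter case the vector is antisymmetric.
open Matrix in
theorem eigenvalueSet_blowUp_subset {p : ℕ} {P : Matrix (Fin p) (Fin p) ℝ} {x μ : ℝ}
    (hμ : μ ∈ eigenvalueSet (blowUp P x)) : μ ∈ eigenvalueSet P ∨ μ = x := by
  obtain ⟨v, hv, h⟩ := hasEigenvalue_toLin'_iff.mp hμ
  by_cases h0 : foldVec v = 0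
  · right
    obtain ⟨i, hi⟩ := Function.ne_iff.mp hv
    have h1 := congrFun h i
    rw [blowUp_mulVec, h0] at h1
    simp at h1
    exact (h1.resolve_right hi).symm
  · left
    refine hasEigenvalue_toLin'_iff.mpr ⟨foldVec v, h0, ?_⟩
    rw [← foldVec_blowUp_mulVec P x, h]
    ext a; simp [foldVec]; ring

open Matrix in
theorem subset_eigenvalueSet_blowUp {p : ℕ} {P : Matrix (Fin p) (Fin p) ℝ} {x μ : ℝ}
    (hμ : μ ∈ eigenvalueSet P) : μ ∈ eigenvalueSet (blowUp P x) := by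
  obtain ⟨u, hu, h⟩ := hasEigenvalue_toLin'_iff.mp hμ
  have h1 : foldVec (fun i : Fin (p * 2) => u i.divNat) = (2 : ℝ) • u := by
    ext a; simp [foldVec, divNat_finProdFinEquiv]; ring
  refine hasEigenvalue_toLin'_iff.mpr ⟨fun i => u i.divNat, fun h0 => hu ?_, ?_⟩
  · ext a
    have := congrFun h0 (finProdFinEquiv (a, 0))
    simp only [divNat_finProdFinEquiv] at this
    exact this
  · ext i
    rw [blowUp_mulVec, h1, mulVec_smul, h]
    simp

open Matrix in
theorem mem_eigenvalueSet_blowUp {p : ℕ} (hp : 0 < p) (P : Matrix (Fin p) (Fin p) ℝ) (x : ℝ) :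
    x ∈ eigenvalueSet (blowUp P x) := by
  let v : Fin (p * 2) → ℝ := fun i => if i.modNat = 0 then 1 else -1
  have hmod : ∀ (a : Fin p) (b : Fin 2), (finProdFinEquiv (a, b)).modNat = b :=
    fun a b => congrArg Prod.snd (finProdFinEquiv.symm_apply_apply (a, b))
  have h0 : foldVec v = 0 := by
    ext a; simp [foldVec, v, hmod]
  refine hasEigenvalue_toLin'_iff.mpr ⟨v, fun hv => ?_, ?_⟩
  · have := congrFun hv (finProdFinEquiv (⟨0, hp⟩, 0))
    simp [v, hmod] at this
  · ext i
    rw [blowUp_mulVec, h0]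
    simp

/-! ### The network -/

/-- The graph on `2 * p` vertices in which the pairs `{2 * a, 2 * a + 1}` form a thick path. -/
def thickPath (p : ℕ) : SimpleGraph (Fin (p * 2)) where
  Adj i j := i ≠ j ∧ (i : ℕ) / 2 ≤ j / 2 + 1 ∧ (j : ℕ) / 2 ≤ i / 2 + 1
  symm := ⟨fun _ _ h => ⟨h.1.symm, h.2.2, h.2.1⟩⟩
  loopless := ⟨fun _ h => h.1 rfl⟩

theorem thickPath_connected {p : ℕ} (hp : 0 < p) : (thickPath p).Connected := by
  have : SimpleGraph.pathGraph (p * 2) ≤ thickPath p := by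
    intro i j hij
    rw [SimpleGraph.pathGraph_adj] at hij
    refine ⟨fun h => ?_, by omega, by omega⟩
    rw [h] at hij
    omega
  refine SimpleGraph.Connected.mono this ?_
  obtain ⟨m, hm⟩ : ∃ m, p * 2 = m + 1 := ⟨p * 2 - 1, by omega⟩
  rw [hm]
  exact SimpleGraph.pathGraph_connected m

open Matrix in
theorem lapMatrix_pathGraph_mulVec_eq_zero_iff {p : ℕ} (hp : 0 < p) (u : Fin p → ℝ) :
    (SimpleGraph.pathGraph p).lapMatrix ℝ *ᵥ u = 0 ↔ ∃ c : ℝ, u = fun _ => c := by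
  rw [SimpleGraph.lapMatrix_mulVec_eq_zero_iff_forall_reachable]
  constructor
  · intro h
    refine ⟨u ⟨0, hp⟩, funext fun j => h _ _ ?_⟩
    obtain ⟨m, rfl⟩ : ∃ m, p = m + 1 := ⟨p - 1, by omega⟩
    exact (SimpleGraph.pathGraph_connected m).preconnected _ _
  · rintro ⟨c, rfl⟩ _ _ _
    rfl

/-- If `γ` is at most the eigengap of the path, it is the eigengap of a gossip matrix on the thick
path. -/
theorem exists_gossip_thickPath {p : ℕ} (hp : 2 ≤ p) {γ : ℝ} (hγ : 0 < γ) (hγ1 : γ ≤ 1)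
    (h : ∀ μ ∈ eigenvalueSet ((SimpleGraph.pathGraph p).lapMatrix ℝ) \ {0},
      ∀ ν ∈ eigenvalueSet ((SimpleGraph.pathGraph p).lapMatrix ℝ) \ {0}, γ * μ ≤ ν) :
    ∃ W, IsGossipMatrix (thickPath p) W ∧ HasEigengap W γ := by
  obtain ⟨l, hl, hmin⟩ := exists_isLeast_path_eigenvalue hp
  set P := (SimpleGraph.pathGraph p).lapMatrix ℝ with hPdef
  have hPs : P.PosSemidef := SimpleGraph.posSemidef_lapMatrix ℝ _
  have hP : P.IsSymm := SimpleGraph.isSymm_lapMatrix ℝ _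
  have hl0 : 0 < l := lt_of_le_of_ne (eigenvalueSet_nonneg hPs hl.1) (Ne.symm hl.2)
  have hx : 0 < l / γ := by positivity
  have hlx : l ≤ l / γ := by rw [le_div_iff₀ hγ]; nlinarith
  -- By `h`, the added eigenvalue `l / γ` dominates all those of `P`; as `γ ≤ 1`, it is also at
  -- least `l`.
  refine ⟨blowUp P (l / γ), ⟨isSymm_blowUp hP _, posSemidef_blowUp hPs hP hx.le,
    ker_blowUp (lapMatrix_pathGraph_mulVec_eq_zero_iff (by omega)) hx.ne', ?_⟩,
    l, l / γ, ⟨⟨subset_eigenvalueSet_blowUp hl.1, hl.2⟩, ?_⟩,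
    ⟨mem_eigenvalueSet_blowUp (by omega) P _, ?_⟩, by field_simp⟩
  · intro i j hij
    by_contra! hcon
    apply hij
    have h1 : ¬((i : ℕ) / 2 ≤ j / 2 + 1 ∧ (j : ℕ) / 2 ≤ i / 2 + 1) :=
      fun h => hcon.2 ⟨hcon.1, h⟩
    have h2 : i.divNat ≠ j.divNat := by
      intro h; apply h1
      have := congrArg Fin.val h
      simp only [Fin.coe_divNat] at this
      omega
    have h3 : P i.divNat j.divNat = 0 := by
      rw [hPdef, SimpleGraph.lapMatrix, Matrix.sub_apply, SimpleGraph.degMatrix,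
        Matrix.diagonal_apply_ne _ h2, SimpleGraph.adjMatrix_apply, if_neg, sub_zero]
      rw [SimpleGraph.pathGraph_adj]
      simp only [Fin.coe_divNat]
      omega
    simp [blowUp, h2, h3, hcon.1]
  · rintro μ ⟨hμ, hμ0⟩
    rcases eigenvalueSet_blowUp_subset hμ with h1 | rfl
    · exact hmin ⟨h1, hμ0⟩
    · exact hlx
  · intro μ hμ
    rcases eigenvalueSet_blowUp_subset hμ with h1 | rfl
    · by_cases hμ0 : μ = 0
      · rw [hμ0]; exact hx.le
      · rw [le_div_iff₀ hγ, mul_comm]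
        exact h μ ⟨h1, hμ0⟩ l hl
    · exact le_rfl

/-- A network with eigengap `γ`, two thirds of whose nodes form two groups at a distance `Δ` of
order `1 / √γ`; the height `h` is the distance to the first group, truncated at `Δ`. -/
theorem exists_network {γ : ℝ} (hγ : 0 < γ) (hγ1 : γ ≤ 1) :
    ∃ (n : ℕ) (G : SimpleGraph (Fin n)) (W : Matrix (Fin n) (Fin n) ℝ),
      G.Connected ∧ IsGossipMatrix G W ∧ HasEigengap W γ ∧
      ∃ (h : Fin n → ℕ) (Δ s : ℕ), 0 < Δ ∧ 1 / √γ ≤ 12 * Δ ∧ 0 < n ∧ n ≤ 3 * s ∧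
        (∀ i, h i ≤ Δ) ∧ (∀ i j, G.Adj i j → h i ≤ h j + 1) ∧
        (Finset.univ.filter fun i => h i = 0).card = s ∧
        (Finset.univ.filter fun i => h i = Δ).card = s := by
  have hγs : 0 < √γ := Real.sqrt_pos.mpr hγ
  -- The path will have `3 * r + 2` vertices: `r + 1` at each end for the groups and `r` in between,
  -- hence `Δ = r + 1`. The first bound makes `Δ` large enough; the second keeps the eigengap of the
  -- path above `γ`.
  obtain ⟨r, hr1, hr2⟩ : ∃ r : ℕ, 1 / √γ ≤ 12 * (r + 1 : ℕ) ∧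
      (0 < r → 6 * ((r : ℝ) + 1) ≤ 1 / √γ) := by
    have h1 := Nat.lt_floor_add_one (1 / √γ / 6)
    have h2 := Nat.floor_le (a := 1 / √γ / 6) (by positivity)
    set q := ⌊1 / √γ / 6⌋₊
    refine ⟨q - 1, ?_, fun hq => ?_⟩
    · have h3 : (q : ℝ) + 1 ≤ 2 * (q - 1 + 1 : ℕ) := by
        exact_mod_cast (by omega : q + 1 ≤ 2 * (q - 1 + 1))
      linarith
    · have h3 : ((q - 1 : ℕ) : ℝ) + 1 = q := by exact_mod_cast (by omega : q - 1 + 1 = q)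
      rw [h3]; linarith
  have hgap : ∀ μ ∈ eigenvalueSet ((SimpleGraph.pathGraph (3 * r + 2)).lapMatrix ℝ) \ {0},
      ∀ ν ∈ eigenvalueSet ((SimpleGraph.pathGraph (3 * r + 2)).lapMatrix ℝ) \ {0}, γ * μ ≤ ν := by
    rintro μ ⟨hμ, hμ0⟩ ν ⟨hν, hν0⟩
    -- For `r = 0` the path has two vertices and a single nonzero eigenvalue: its eigengap is `1`,
    -- which allows all `γ ≤ 1`.
    rcases Nat.eq_zero_or_pos r with rfl | hr
    · rw [path_two_eigenvalue hμ hμ0, path_two_eigenvalue hν hν0]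
      linarith
    · refine le_trans ?_ (le_path_eigenvalue hν hν0)
      have h1 := hr2 hr
      have h2 : 6 * ((r : ℝ) + 1) * √γ ≤ 1 := (le_div_iff₀ hγs).mp h1
      have h3 : 2 * (((3 * r + 2 : ℕ) : ℝ) * √γ) ≤ 1 := by push_cast; nlinarith
      have h4 : (0 : ℝ) < ((3 * r + 2 : ℕ) : ℝ) := by positivity
      have h5 : 4 * (((3 * r + 2 : ℕ) : ℝ) ^ 2 * γ) ≤ 1 := by
        calc 4 * (((3 * r + 2 : ℕ) : ℝ) ^ 2 * γ) = (2 * (((3 * r + 2 : ℕ) : ℝ) * √γ)) ^ 2 := by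
              rw [mul_pow, mul_pow, Real.sq_sqrt hγ.le]; norm_num
          _ ≤ 1 := pow_le_one₀ (by positivity) h3
      rw [le_div_iff₀ (by positivity)]
      calc γ * μ * ((3 * r + 2 : ℕ) : ℝ) ^ 2 ≤ γ * 4 * ((3 * r + 2 : ℕ) : ℝ) ^ 2 := by
            gcongr; exact path_eigenvalue_le hμ
        _ ≤ 1 := by linarith
  obtain ⟨W, hW, hWγ⟩ := exists_gossip_thickPath (by omega) hγ hγ1 hgap
  refine ⟨_, _, W, thickPath_connected (by omega), hW, hWγ,
    fun i => min ((i : ℕ) / 2 - r) (r + 1), r + 1, 2 * r + 2, by omega, hr1, by omega, by omega,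
    fun i => min_le_right _ _, ?_, ?_, ?_⟩
  · rintro i j ⟨-, h1, h2⟩
    dsimp only
    omega
  · have h1 : (Finset.univ.filter fun i : Fin ((3 * r + 2) * 2) =>
        min ((i : ℕ) / 2 - r) (r + 1) = 0) =
        Finset.univ.filter fun i : Fin ((3 * r + 2) * 2) => (i : ℕ) < 2 * r + 2 :=
      Finset.filter_congr fun i _ => by omega
    rw [h1, Fin.card_filter_val_lt]
    omega
  · have h1 : (Finset.univ.filter fun i : Fin ((3 * r + 2) * 2) =>
        min ((i : ℕ) / 2 - r) (r + 1) = r + 1) =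
        Finset.univ.filter fun i : Fin ((3 * r + 2) * 2) => ¬ (i : ℕ) < 4 * r + 2 :=
      Finset.filter_congr fun i _ => by omega
    have h2 := Finset.card_filter_add_card_filter_not (s := Finset.univ)
      fun i : Fin ((3 * r + 2) * 2) => (i : ℕ) < 4 * r + 2
    rw [Fin.card_filter_val_lt, Finset.card_univ, Fintype.card_fin] at h2
    rw [h1]
    omega

/-! ### From the two bounds to the rates -/

/-- When the communication term dominates, the root is at most `√2 / A ≤ 3 / 2 / A`; the constant is
`108 = 12 * 6 * (3 / 2)`. -/
theorem rate_le_of_comm {A B x : ℝ} (hA : 0 < A) (hAB : B ≤ 1 / A ^ 2) (hx : 0 < x) {m : ℝ}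
    (hm : 0 < m) (hmA : m ≤ 6 * A) : x / 108 * √(1 / A ^ 2 + B) ≤ x / (12 * m) := by
  have h1 : √(1 / A ^ 2 + B) ≤ 3 / 2 / A := by
    refine Real.sqrt_le_iff.mpr ⟨by positivity, ?_⟩
    rw [div_pow]
    calc 1 / A ^ 2 + B ≤ 2 / A ^ 2 := by
          have : 2 / A ^ 2 = 1 / A ^ 2 + 1 / A ^ 2 := by ring
          linarith
      _ ≤ _ := by gcongr; norm_num
  calc x / 108 * √(1 / A ^ 2 + B) ≤ x / 108 * (3 / 2 / A) := by gcongr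
    _ = x / (12 * (6 * A)) := by field_simp; norm_num
    _ ≤ _ := by gcongr

theorem rate_le_of_comp {a B x : ℝ} (hB : 0 < B) (hAB : a ≤ 1 / B) (hx : 0 < x) {m : ℝ}
    (hm : 0 < m) (hmB : m ≤ B) : x / 108 * √(a + 1 / B) ≤ x / (2 * √m) := by
  have h0 : 0 < √B := Real.sqrt_pos.mpr hB
  have h1 : √(a + 1 / B) ≤ 3 / 2 / √B := by
    refine Real.sqrt_le_iff.mpr ⟨by positivity, ?_⟩
    rw [div_pow, Real.sq_sqrt hB.le]
    calc a + 1 / B ≤ 2 / B := by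
          have : 2 / B = 1 / B + 1 / B := by ring
          linarith
      _ ≤ _ := by gcongr; norm_num
  calc x / 108 * √(a + 1 / B) ≤ x / 108 * (3 / 2 / √B) := by gcongr
    _ = x / (72 * √B) := by field_simp; norm_num
    _ ≤ x / (2 * √m) := by
      have h2 : 0 < √m := Real.sqrt_pos.mpr hm
      have h3 : √m ≤ √B := Real.sqrt_le_sqrt hmB
      gcongr
      norm_num

theorem le_floor_of_two_le {x : ℝ} (hx : 2 ≤ x) : ∃ k : ℕ, (k : ℝ) + 1 ≤ x ∧ x / 4 ≤ k := by
  have h1 := Nat.lt_floor_add_one x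
  have h2 := Nat.floor_le (a := x) (by linarith)
  have h3 : 2 ≤ ⌊x⌋₊ := Nat.le_floor (by exact_mod_cast hx)
  obtain ⟨k, hk⟩ : ∃ k, ⌊x⌋₊ = k + 1 := ⟨⌊x⌋₊ - 1, by omega⟩
  rw [hk] at h1 h2 h3
  push_cast at h1 h2
  have h4 : (1 : ℝ) ≤ k := by exact_mod_cast (by omega : 1 ≤ k)
  exact ⟨k, h2, by linarith⟩

theorem mainTheorem2 :
    ∃ C > (0 : ℝ), ∃ c > (0 : ℝ),
      ∀ L R γ : ℝ, 0 < L → 0 < R → 0 < γ → γ ≤ 1 →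
        ∃ (n : ℕ) (G : SimpleGraph (Fin n)) (W : Matrix (Fin n) (Fin n) ℝ),
          G.Connected ∧ IsGossipMatrix G W ∧ HasEigengap W γ ∧
          -- the lower bound on the error at time `t`
          (∀ (d : ℕ) (τ t : ℝ), 0 < τ → 0 ≤ t →
            t < ((d : ℝ) - 2) / 2 * min (τ / Real.sqrt γ) 1 →
            ∃ f : Fin n → Vec d → ℝ, LocalRegularity f L ∧
              ∃ fmin : ℝ, IsLeast (avgFun f '' Metric.closedBall 0 R) fmin ∧
                ∀ g : Fin n → Vec d → Vec d, (∀ i, IsSubgradientOracle (f i) (g i)) →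
                  ∀ P : BlackBoxProcedure G τ g, ∀ i : Fin n,
                    R * L / 108 *
                        Real.sqrt (1 / (1 + 2 * t * Real.sqrt γ / τ) ^ 2 + 1 / (1 + t))
                      ≤ avgFun f (P.out i t) - fmin) ∧
          -- the lower bound on the time to reach a precision `ε` in large dimension
          (∀ τ ε : ℝ, 0 < τ → 0 < ε → ε ≤ c * (R * L) →
            ∃ D : ℕ, ∀ d : ℕ, D ≤ d →
              ∃ f : Fin n → Vec d → ℝ, LocalRegularity f L ∧
                ∃ fmin : ℝ, IsLeast (avgFun f '' Metric.closedBall 0 R) fmin ∧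
                  ∀ g : Fin n → Vec d → Vec d, (∀ i, IsSubgradientOracle (f i) (g i)) →
                    ∀ P : BlackBoxProcedure G τ g, ∀ (i : Fin n) (t : ℝ), 0 ≤ t →
                      avgFun f (P.out i t) - fmin ≤ ε →
                        C * (R * L / ε * (τ / Real.sqrt γ) + (R * L / ε) ^ 2) ≤ t) := by
  -- `c = 1 / 48` gives `R * L / ε / 24 ≥ 2`, so that the chain has a positive `k`. In `2304 = 2 *
  -- 24 * 4 * 12`, the factors come from bounding the sum by twice its larger term, from `k + 1 ≤ ρ
  -- / 24`, from `x / 4 ≤ k` and from `1 / √γ ≤ 12 * Δ`.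
  refine ⟨1 / 2304, by norm_num, 1 / 48, by norm_num, ?_⟩
  intro L R γ hL hR hγ hγ1
  obtain ⟨n, G, W, hG, hW, hWγ, h, Δ, s, hΔ, hΔγ, hn, hs, hle, hadj, h0, h1⟩ :=
    exists_network hγ hγ1
  have hγs : 0 < √γ := Real.sqrt_pos.mpr hγ
  have hΔ' : (0 : ℝ) < Δ := by exact_mod_cast hΔ
  have hΔγ' : 1 ≤ 12 * Δ * √γ := (div_le_iff₀ hγs).mp hΔγ
  have hRL : 0 < R * L := by positivity
  refine ⟨n, G, W, hG, hW, hWγ, ?_, ?_⟩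
  · intro d τ t hτ ht htd
    have hd : 0 < (d : ℝ) - 2 := by
      by_contra hcon
      have : ((d : ℝ) - 2) / 2 * min (τ / √γ) 1 ≤ 0 :=
        mul_nonpos_of_nonpos_of_nonneg (by linarith) (by positivity)
      linarith
    have htd' : 2 * t < d - 2 := by
      have : ((d : ℝ) - 2) / 2 * min (τ / √γ) 1 ≤ (d - 2) / 2 * 1 := by
        gcongr; exact min_le_right _ _
      linarith
    have hd2 : 2 < d := by exact_mod_cast (by linarith : (2 : ℝ) < d)
    set A := 1 + 2 * t * √γ / τ with hA
    have hA1 : 1 ≤ A := by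
      have : 0 ≤ 2 * t * √γ / τ := by positivity
      linarith
    rcases le_total (1 / (1 + t)) (1 / A ^ 2) with hc | hc
    · set q := ⌊t / (Δ * τ)⌋₊ with hq
      have hq1 : (q : ℝ) ≤ t / (Δ * τ) := Nat.floor_le (by positivity)
      have hq2 : t / (Δ * τ) < q + 1 := Nat.lt_floor_add_one _
      -- With `k = q + 1`, fewer than `k` crossings fit in time `t`. If the dimension is too small
      -- for this, `k + 1 = d` and the computation limit `t < k + 1` takes over.
      obtain ⟨f, hf, fmin, hmin, hlow⟩ := exists_hard_chain (d := d) (k := min (d - 1) (q + 1))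
        (G := G) hΔ hle hadj h0 h1 hn hs hL hR (by omega)
      refine ⟨f, hf, fmin, hmin, fun g hg P i => ?_⟩
      refine le_trans ?_ (hlow g hg τ hτ P i t ht ?_)
      · refine rate_le_of_comm (by linarith) hc hRL (by positivity) ?_
        have e1 : ((min (d - 1) (q + 1) : ℕ) : ℝ) ≤ q + 1 := by exact_mod_cast min_le_right _ _
        have e2 : t / (Δ * τ) ≤ 6 * (2 * t * √γ / τ) := by
          rw [div_le_iff₀ (by positivity)]
          calc t ≤ t * (12 * Δ * √γ) := le_mul_of_one_le_right ht hΔγ'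
            _ = _ := by field_simp; ring
        linarith
      · rcases le_total (d - 1) (q + 1) with hdq | hdq
        · right
          rw [min_eq_left hdq, Nat.cast_sub (by omega)]
          push_cast
          linarith
        · left
          rw [min_eq_right hdq, mul_assoc]
          push_cast
          exact (div_lt_iff₀ (by positivity)).mp hq2
    · have hq1 : (⌊t⌋₊ : ℝ) ≤ t := Nat.floor_le ht
      have hk : ⌊t⌋₊ + 1 ≤ d := by exact_mod_cast (by linarith : (⌊t⌋₊ : ℝ) + 1 ≤ d)
      obtain ⟨f, hf, fmin, hmin, hlow⟩ := exists_hard_max (G := G) hn hL hR hk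
      refine ⟨f, hf, fmin, hmin, fun g hg P i => ?_⟩
      refine le_trans ?_ (hlow g hg τ hτ P i t ht (Nat.lt_floor_add_one t))
      exact rate_le_of_comp (by linarith) hc hRL (by positivity) (by linarith)
  · intro τ ε hτ hε hεc
    set ρ := R * L / ε with hρ
    have hρ48 : 48 ≤ ρ := by rw [hρ, le_div_iff₀ hε]; linarith
    have hρε : R * L = ρ * ε := by rw [hρ]; field_simp
    rcases le_total (ρ ^ 2) (ρ * (τ / √γ)) with hc | hc
    -- With `k + 1 ≤ ρ / 24`, the error is at least `2 * ε` until time `k * Δ * τ`.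
    · obtain ⟨k, hk1, hk2⟩ := le_floor_of_two_le (x := ρ / 24) (by linarith)
      refine ⟨k + 1, fun d hd => ?_⟩
      obtain ⟨f, hf, fmin, hmin, hlow⟩ := exists_hard_chain
        (G := G) hΔ hle hadj h0 h1 hn hs hL hR hd
      refine ⟨f, hf, fmin, hmin, fun g hg P i t ht hε' => ?_⟩
      by_contra! hcon
      have e1 : t < k * Δ * τ := by
        refine hcon.trans_le ?_
        calc 1 / 2304 * (ρ * (τ / √γ) + ρ ^ 2) ≤ 1 / 2304 * (ρ * (τ / √γ) + ρ * (τ / √γ)) := by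
              gcongr
          _ = ρ / 24 / 4 * (1 / √γ / 12) * τ := by ring
          _ ≤ k * Δ * τ := by gcongr; linarith
      have e2 := (hlow g hg τ hτ P i t ht (Or.inl e1)).trans hε'
      rw [div_le_iff₀ (by positivity), hρε, mul_comm] at e2
      have := le_of_mul_le_mul_left e2 hε
      linarith
    -- Any divisor above `4` gives `√(k + 1) < ρ / 2`, hence an error above `ε` before time `k + 1`.
    · obtain ⟨k, hk1, hk2⟩ := le_floor_of_two_le (x := ρ ^ 2 / 5) (by nlinarith)
      refine ⟨k + 1, fun d hd => ?_⟩
      obtain ⟨f, hf, fmin, hmin, hlow⟩ := exists_hard_max (G := G) hn hL hR hd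
      refine ⟨f, hf, fmin, hmin, fun g hg P i t ht hε' => ?_⟩
      by_contra! hcon
      have e1 : t < k + 1 := by
        refine hcon.trans_le ?_
        have : 0 < ρ ^ 2 := by positivity
        linarith
      have e2 := (hlow g hg τ hτ P i t ht e1).trans hε'
      rw [div_le_iff₀ (by positivity), hρε, mul_comm] at e2
      have e3 := le_of_mul_le_mul_left e2 hε
      have e4 : √((k : ℝ) + 1) < ρ / 2 := by
        rw [Real.sqrt_lt' (by linarith)]
        have : 0 < ρ ^ 2 := by positivity
        linarith
      linarith
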